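/- \textbf{Setting.} A \emph{labelled stochastic transition system} (LSTS) $\mathcal T=(S,\Sigma,\kappa,\mathrm{AP},\mathcal L)$ consists of a measurable space $(S,\Sigma)$, a Markov kernel $\kappa$ on it, a finite set $\mathrm{AP}$ and a measurable map $\mathcal L:S\to 2^{\mathrm{AP}}$. For a probability measure $\mu$ on $S$, $\mathbb P^{\mathcal T}_\mu$ denotes the law on infinite paths $S^{\mathbb N}$ of the Markov chain with initial distribution $\mu$ and kernel $\kappa$, and $\Omega_{\mathcal T}(\mu)=\int \kappa(s,\cdot)\,\mu(ds)$. For $B\in\Sigma$, $\mathsf F B$ is the event that the path visits $B$; $B$ is an \emph{attractor} if $\mathbb P^{\mathcal T}_\mu(\mathsf F B)=1$ for every probability measure $\mu$ on $S$. For a path $\rho=s_0s_1\dots$, $\mathsf{Inf}(\rho)$ is the set of $a\in\mathrm{AP}$ with $a\in\mathcal L(s_j)$ for infinitely many $j$. $\mathcal T$ is a \emph{denumerable Markov chain} (DMC) if $S$ is countable and $\Sigma=2^S$. Let $\mathcal T_i=(S_i,\Sigma_i,\kappa_i,\mathrm{AP},\mathcal L_i)$, $i=1,2$, be LSTSs and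 let $\alpha:S_1\to S_2$ be measurable, with push-forward $\alpha_\#$. $\mathcal T_2$ is an \emph{$\alpha$-abstraction} of $\mathcal T_1$ if for every probability measure $\mu$ on $S_1$ the measures $\alpha_\#(\Omega_{\mathcal T_1}(\mu))$ and $\Omega_{\mathcal T_2}(\alpha_\#(\mu))$ have the same null sets, $\alpha(s)=\alpha(s')$ implies $\mathcal L_1(s)=\mathcal L_1(s')$, and $\mathcal L_2(\alpha(s))=\mathcal L_1(s)$ for all $s,s'\in S_1$. The abstraction is \emph{sound} if for every probability measure $\mu$ on $S_1$ and every $B\in\Sigma_2$, $\mathbb P^{\mathcal T_2}_{\alpha_\#(\mu)}(\mathsf F B)=1$ implies $\mathbb P^{\mathcal T_1}_{\mu}(\mathsf F\,\alpha^{-1}(B))=1$. A \emph{deterministic Muller automaton} (DMA) $\mathcal M=(Q,q_0,E,\mathcal F)$ over $\mathrm{AP}$ consists of a finite set $Q$, $q_0\in Q$, a set $E\subseteq Q\times 2^{\mathrm{AP}}\times Q$ such that for every $(q,u)$ there is exactly one $q'$ with $(q,u,q')\in E$, and $\mathcal F\subseteq 2^Q$. The product $\mathcal T\ltimes\mathcal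 M$ is the LSTS over the atomic propositions $Q$ with state space $S\times Q$ (product $\sigma$-algebra, $Q$ discrete), labels $\mathcal L'(s,q)=\{q\}$, and kernel $\kappa'((s,q),A\times\{q'\})=\kappa(s,A)$ if $(q,\mathcal L(s),q')\in E$, and $0$ otherwise. Write $\alpha_{\mathcal M}(s,q)=(\alpha(s),q)$. \textbf{Statement.} Let $\mathcal T_1$ and $\mathcal T_2$ be LSTSs over $\mathrm{AP}$ such that $\mathcal T_2$ is a DMC with a finite attractor and $\mathcal T_2$ is an $\alpha$-abstraction of $\mathcal T_1$. Let $\mathcal M=(Q,q_0,E,\mathcal F)$ be a DMA over $\mathrm{AP}$, and assume that $\mathcal T_2\ltimes\mathcal M$ is a sound $\alpha_{\mathcal M}$-abstraction of $\mathcal T_1\ltimes\mathcal M$. Then for every probability measure $\mu$ on $S_1$, \[ \mathbb P^{\mathcal T_1\ltimes\mathcal M}_{\mu\times\delta_{q_0}}(\mathsf{Inf}\in\mathcal F)=1 \quad\Longleftrightarrow\quad \mathbb P^{\mathcal T_2\ltimes\mathcal M}_{(\alpha_{\mathcal M})_\#(\mu\times\delta_{q_0})}(\mathsf{Inf}\in\mathcal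 F)=1 . \] -/

import Mathlib

open MeasureTheory ProbabilityTheory

/-- A stochastic transition system on the measurable space `S`: a Markov kernel on `S`. -/
structure STS (S : Type*) [MeasurableSpace S] where
  kernel : Kernel S S
  isMarkov : IsMarkovKernel kernel

attribute [instance] STS.isMarkov

namespace STS

variable {S S₁ S₂ : Type*} [MeasurableSpace S] [MeasurableSpace S₁] [MeasurableSpace S₂]

/-- The law on infinite paths `ℕ → S` (with the product `σ`-algebra, which is generated by the
cylinders) of the chain with initial distribution `μ` and transition kernel `T.kernel`: given the
path up to time `n`, the state at time `n + 1` has law `T.kernel (s n)`. -/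
noncomputable def pathMeasure (T : STS S) (μ : Measure S) : Measure (ℕ → S) :=
  Kernel.trajMeasure (X := fun _ => S) μ fun n =>
    T.kernel.comap (fun h : (i : Finset.Iic n) → S => h ⟨n, Finset.mem_Iic.2 le_rfl⟩)
      (measurable_pi_apply _)

/-- The measure transformer `Ω_T(μ)(A) = ∫ κ(s, A) μ(ds)`. -/
noncomputable def transform (T : STS S) (μ : Measure S) : Measure S :=
  μ.bind T.kernel

/-- The event `F B`: the path visits `B` at some time. -/
def eventually (B : Set S) : Set (ℕ → S) := {ρ | ∃ n, ρ n ∈ B}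

/-- `B` is an attractor: it is reached almost surely from every initial distribution. -/
def IsAttractor (T : STS S) (B : Set S) : Prop :=
  MeasurableSet B ∧
    ∀ μ : Measure S, IsProbabilityMeasure μ → T.pathMeasure μ (eventually B) = 1

/-- `T₂` is an `α`-abstraction of `T₁`: for every distribution `μ` on `S₁`, the distributions
`α_#(Ω_{T₁}(μ))` and `Ω_{T₂}(α_#(μ))` have the same null sets. -/
def IsAbstraction (α : S₁ → S₂) (T₁ : STS S₁) (T₂ : STS S₂) : Prop :=
  ∀ μ : Measure S₁, IsProbabilityMeasure μ → ∀ A : Set S₂, MeasurableSet A →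
    ((T₁.transform μ).map α A = 0 ↔ T₂.transform (μ.map α) A = 0)

/-- Soundness: almost-sure reachability of `B` in `T₂` from `α_#(μ)` implies almost-sure
reachability of `α⁻¹(B)` in `T₁` from `μ`, for every measurable `B` and every distribution `μ`. -/
def IsSound (α : S₁ → S₂) (T₁ : STS S₁) (T₂ : STS S₂) : Prop :=
  ∀ μ : Measure S₁, IsProbabilityMeasure μ → ∀ B : Set S₂, MeasurableSet B →
    T₂.pathMeasure (μ.map α) (eventually B) = 1 →
      T₁.pathMeasure μ (eventually (α ⁻¹' B)) = 1

end STS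

/-- A labelled stochastic transition system over the atomic propositions `AP`. For finite `AP`, the
`σ`-algebra on `Set AP` is the discrete one. -/
structure LSTS (S AP : Type*) [MeasurableSpace S] extends STS S where
  label : S → Set AP
  measurable_label : Measurable label

namespace LSTS

variable {S S₁ S₂ AP : Type*} [MeasurableSpace S] [MeasurableSpace S₁] [MeasurableSpace S₂]

/-- The set of atomic propositions that hold infinitely often along the path `ρ`. -/
def inf (T : LSTS S AP) (ρ : ℕ → S) : Set AP := {a | {j | a ∈ T.label (ρ j)}.Infinite}

/-- `T₂` is an `α`-abstraction of `T₁` as a labelled system. -/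
structure IsAbstraction (α : S₁ → S₂) (T₁ : LSTS S₁ AP) (T₂ : LSTS S₂ AP) : Prop where
  toSTS : STS.IsAbstraction α T₁.toSTS T₂.toSTS
  label_eq_of_eq : ∀ s s' : S₁, α s = α s' → T₁.label s = T₁.label s'
  label_map : ∀ s : S₁, T₂.label (α s) = T₁.label s

end LSTS

/-- A deterministic (and complete) Muller automaton over `AP` with locations `Q`; it is used with
`AP` and `Q` finite. -/
structure DMA (AP Q : Type*) where
  init : Q
  edges : Set (Q × Set AP × Q)
  acc : Set (Set Q)
  deterministic : ∀ q u q₁ q₂, (q, u, q₁) ∈ edges → (q, u, q₂) ∈ edges → q₁ = q₂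
  complete : ∀ q u, ∃ q', (q, u, q') ∈ edges

namespace DMA

variable {AP Q : Type*}

/-- The unique location `q'` with an edge `(q, u, q')`. -/
noncomputable def next (M : DMA AP Q) (q : Q) (u : Set AP) : Q := (M.complete q u).choose

theorem next_eq_iff (M : DMA AP Q) (q : Q) (u : Set AP) (q' : Q) :
    M.next q u = q' ↔ (q, u, q') ∈ M.edges :=
  ⟨fun h => h ▸ (M.complete q u).choose_spec,
    fun h => M.deterministic q u _ _ (M.complete q u).choose_spec h⟩

end DMA

namespace LSTS

variable {S AP Q : Type*} [MeasurableSpace S] [Finite AP] [Finite Q] [MeasurableSpace Q]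
  [DiscreteMeasurableSpace Q]

theorem measurable_next (T : LSTS S AP) (M : DMA AP Q) :
    Measurable fun p : S × Q => M.next p.2 (T.label p.1) := by
  have h : Measurable fun x : Q × Set AP => M.next x.1 x.2 := measurable_of_countable _
  exact h.comp (measurable_snd.prodMk (T.measurable_label.comp measurable_fst))

/-- The product `T ⋉ M`: from `(s, q)`, the first component moves according to `T`, the second one
moves to the unique `q'` with `(q, L(s), q') ∈ E`; the state `(s, q)` carries the label `q`. -/
noncomputable def product (T : LSTS S AP) (M : DMA AP Q) : LSTS (S × Q) Q where
  kernel := (T.kernel.comap Prod.fst measurable_fst).prod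
    (Kernel.deterministic (fun p : S × Q => M.next p.2 (T.label p.1)) (T.measurable_next M))
  isMarkov := inferInstance
  label p := {p.2}
  measurable_label := (measurable_of_countable fun q : Q => ({q} : Set Q)).comp measurable_snd

open Classical in
theorem product_kernel_apply (T : LSTS S AP) (M : DMA AP Q) (s : S) (q q' : Q) (A : Set S) :
    (T.product M).kernel (s, q) (A ×ˢ {q'}) =
      if (q, T.label s, q') ∈ M.edges then T.kernel s A else 0 := by
  rw [product, Kernel.prod_apply, Measure.prod_prod, Kernel.comap_apply,
    Kernel.deterministic_apply, Measure.dirac_apply' _ (measurableSet_singleton q')]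
  by_cases h : (q, T.label s, q') ∈ M.edges
  · simp [h, (M.next_eq_iff q (T.label s) q').2 h]
  · simp [h, mt (M.next_eq_iff q (T.label s) q').1 h]

end LSTS

/-!
A denumerable chain with a finite attractor almost surely reaches a recurrent state, from which
every reachable state is visited infinitely often: a set that can be reached from every state of
the attractor is hit with probability bounded away from zero, hence almost surely. If the chain is
a sound abstraction, both facts lift to the abstracted system, so there too the labels seen
infinitely often are those of the states reachable, in the denumerable chain, from the recurrent
state that has been entered. As an abstraction preserves the null sets of all `n`-step laws, the
recurrent states entered with positive probability are those reachable from the support of the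
initial law. Hence, in both systems, `Inf ∈ F` is almost sure if and only if `F` contains these
label sets for all recurrent states so reachable. The product with a Muller automaton inherits both
the abstraction property and, by projecting to the first component, the finite attractor.
-/

theorem ext_of_map_frestrictLe {S : Type*} [MeasurableSpace S] {ν ν' : Measure (ℕ → S)}
    [IsFiniteMeasure ν']
    (h : ∀ n, ν.map (Preorder.frestrictLe (π := fun _ => S) n) = ν'.map (Preorder.frestrictLe n)) :
    ν = ν' := by
  have hν' : IsProjectiveMeasureFamily (α := fun _ : ℕ => S) fun I => ν'.map I.restrict :=
    isProjectiveMeasureFamily_map_restrict fun n => (measurable_pi_apply n).aemeasurable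
  have hν : IsProjectiveLimit (α := fun _ : ℕ => S) ν fun I => ν'.map I.restrict :=
    (isProjectiveLimit_nat_iff hν' ν).2 h
  exact hν.unique fun _ => rfl

theorem map_compProd_comap {X Y Z : Type*} [MeasurableSpace X] [MeasurableSpace Y]
    [MeasurableSpace Z] (μ : Measure X) [SFinite μ] (κ : Kernel Y Z) [IsSFiniteKernel κ]
    {f : X → Y} (hf : Measurable f) :
    (μ ⊗ₘ κ.comap f hf).map (Prod.map f id) = μ.map f ⊗ₘ κ := by
  ext A hA
  rw [Measure.map_apply (by fun_prop) hA, Measure.compProd_apply (by measurability),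
    Measure.compProd_apply hA, lintegral_map (Kernel.measurable_kernel_prodMk_left hA) hf]
  rfl

namespace STS

section PathMeasure

variable {S : Type*} [MeasurableSpace S] (T : STS S) (μ : Measure S)

/-- The transition kernel as a kernel on histories `s₀, …, sₙ`, of which it only uses `sₙ`; this is
the form in which the Ionescu-Tulcea construction consumes it. -/
noncomputable def historyKernel (n : ℕ) : Kernel ((i : Finset.Iic n) → S) S :=
  T.kernel.comap (fun h => h ⟨n, Finset.mem_Iic.2 le_rfl⟩) (measurable_pi_apply _)

instance (n : ℕ) : IsMarkovKernel (T.historyKernel n) := by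
  unfold historyKernel; infer_instance

instance [IsProbabilityMeasure μ] : IsProbabilityMeasure (T.transform μ) := by
  unfold transform; infer_instance

instance [IsProbabilityMeasure μ] : IsProbabilityMeasure (T.pathMeasure μ) :=
  inferInstanceAs (IsProbabilityMeasure (Kernel.trajMeasure (X := fun _ => S) μ T.historyKernel))

/-- The path measure as a kernel in the initial state. -/
noncomputable def pathKernel : Kernel S (ℕ → S) :=
  (Kernel.traj (X := fun _ => S) T.historyKernel 0).comap
    (MeasurableEquiv.piUnique fun _ : Finset.Iic 0 => S).symm (MeasurableEquiv.measurable _)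

instance : IsMarkovKernel T.pathKernel := by
  unfold pathKernel; infer_instance

theorem pathMeasure_eq_bind_pathKernel : T.pathMeasure μ = μ.bind T.pathKernel := by
  change (μ.map _).bind (Kernel.traj (X := fun _ => S) T.historyKernel 0) = _
  ext E hE
  rw [Measure.bind_apply hE (Kernel.aemeasurable _), Measure.bind_apply hE (Kernel.aemeasurable _),
    lintegral_map (Kernel.measurable_coe _ hE) (MeasurableEquiv.measurable _)]
  rfl

theorem pathMeasure_dirac (s : S) : T.pathMeasure (Measure.dirac s) = T.pathKernel s := by
  rw [pathMeasure_eq_bind_pathKernel, Measure.dirac_bind T.pathKernel.measurable]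

theorem pathKernel_map_eval_zero (s : S) :
    (T.pathKernel s).map (fun ρ => ρ 0) = Measure.dirac s := by
  have h_eval : (fun ρ : ℕ → S => ρ 0) =
      (fun h : Finset.Iic 0 → S => h ⟨0, Finset.mem_Iic.2 le_rfl⟩) ∘ Preorder.frestrictLe 0 := rfl
  rw [h_eval, ← Measure.map_map (by fun_prop) (by fun_prop), pathKernel, Kernel.comap_apply,
    Kernel.traj_map_frestrictLe_apply, Kernel.partialTraj_self, Kernel.id_apply,
    Measure.map_dirac' (by fun_prop)]
  rfl

theorem ae_pathKernel_eval_zero (s : S) {C : Set S} (hC : MeasurableSet C) (hs : s ∈ C) :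
    ∀ᵐ ρ ∂T.pathKernel s, ρ 0 ∈ C := by
  refine ae_of_ae_map (measurable_pi_apply 0).aemeasurable ?_
  rw [pathKernel_map_eval_zero]
  exact (ae_dirac_iff hC).2 hs

theorem pathMeasure_map_eval_zero : (T.pathMeasure μ).map (fun ρ => ρ 0) = μ := by
  have h_id : T.pathKernel.map (fun ρ => ρ 0) = Kernel.id := by
    ext s : 1
    rw [Kernel.map_apply _ (by fun_prop), pathKernel_map_eval_zero, Kernel.id_apply]
  rw [pathMeasure_eq_bind_pathKernel, Measure.map_comp _ _ (by fun_prop), h_id, Measure.id_comp]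

/-- A law `ν` on paths is that of a Markov chain with transition kernel `T.kernel` if, at every
time, the next state has law `T.kernel` of the current one, conditionally on the history. -/
def IsMarkovChain (ν : Measure (ℕ → S)) : Prop :=
  ∀ n, ν.map (fun ρ => (Preorder.frestrictLe (π := fun _ => S) n ρ, ρ (n + 1))) =
    ν.map (Preorder.frestrictLe n) ⊗ₘ T.historyKernel n

theorem isMarkovChain_pathMeasure [IsProbabilityMeasure μ] :
    T.IsMarkovChain (T.pathMeasure μ) :=
  fun _ => Kernel.map_frestrictLe_trajMeasure_compProd_eq_map_trajMeasure.symm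

variable {S' : Type*} [MeasurableSpace S'] {T' : STS S'} {f : S → S'}
  {T} {ν ν' : Measure (ℕ → S)}

theorem IsMarkovChain.map_eval_one [SFinite ν] (hν : T.IsMarkovChain ν) :
    ν.map (fun ρ => ρ 1) = T.transform (ν.map fun ρ => ρ 0) := by
  have h_snd := congrArg Measure.snd (hν 0)
  rw [Measure.snd_compProd, Measure.snd_map_prodMk (by fun_prop)] at h_snd
  rw [h_snd, transform]
  ext A hA
  rw [Measure.bind_apply hA (Kernel.aemeasurable _), Measure.bind_apply hA (Kernel.aemeasurable _),
    lintegral_map (Kernel.measurable_coe _ hA) (by fun_prop),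
    lintegral_map (Kernel.measurable_coe _ hA) (by fun_prop)]
  rfl

theorem IsMarkovChain.map_shift [SFinite ν] (hν : T.IsMarkovChain ν) :
    T.IsMarkovChain (ν.map fun ρ n => ρ (n + 1)) := by
  intro n
  let tail : (Finset.Iic (n + 1) → S) → Finset.Iic n → S :=
    fun h i => h ⟨i + 1, Finset.mem_Iic.2 (Nat.succ_le_succ (Finset.mem_Iic.1 i.2))⟩
  have h_tail : Measurable tail := by fun_prop
  calc (ν.map fun ρ n => ρ (n + 1)).map
        (fun ρ => (Preorder.frestrictLe (π := fun _ => S) n ρ, ρ (n + 1)))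
      = (ν.map fun ρ => (Preorder.frestrictLe (π := fun _ => S) (n + 1) ρ, ρ (n + 1 + 1))).map
          (Prod.map tail id) := by
        rw [Measure.map_map (by fun_prop) (by fun_prop),
          Measure.map_map (by fun_prop) (by fun_prop)]
        rfl
    _ = (ν.map (Preorder.frestrictLe (n + 1))).map tail ⊗ₘ T.historyKernel n := by
        rw [hν (n + 1), ← map_compProd_comap _ _ h_tail]
        rfl
    _ = (ν.map fun ρ n => ρ (n + 1)).map (Preorder.frestrictLe n) ⊗ₘ T.historyKernel n := by
        rw [Measure.map_map h_tail (by fun_prop), Measure.map_map (by fun_prop) (by fun_prop)]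
        rfl

theorem IsMarkovChain.map [SFinite ν] (hν : T.IsMarkovChain ν) (hf : Measurable f)
    (h : ∀ s, (T.kernel s).map f = T'.kernel (f s)) :
    T'.IsMarkovChain (ν.map fun ρ n => f (ρ n)) := by
  intro n
  let F : (Finset.Iic n → S) → Finset.Iic n → S' := fun h i => f (h i)
  have hF : Measurable F := by fun_prop
  have h_kernel : (T.historyKernel n).map f = (T'.historyKernel n).comap F hF := by
    ext h' : 1
    rw [Kernel.map_apply _ hf, Kernel.comap_apply]
    exact h _
  calc (ν.map fun ρ n => f (ρ n)).map
        (fun ρ => (Preorder.frestrictLe (π := fun _ => S') n ρ, ρ (n + 1)))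
      = (ν.map fun ρ => (Preorder.frestrictLe (π := fun _ => S) n ρ, ρ (n + 1))).map
          (Prod.map F f) := by
        rw [Measure.map_map (by fun_prop) (by fun_prop),
          Measure.map_map (by fun_prop) (by fun_prop)]
        rfl
    _ = ((ν.map (Preorder.frestrictLe n) ⊗ₘ T.historyKernel n).map (Prod.map id f)).map
          (Prod.map F id) := by
        rw [hν n, Measure.map_map (by fun_prop) (by fun_prop)]
        rfl
    _ = (ν.map (Preorder.frestrictLe n)).map F ⊗ₘ T'.historyKernel n := by
        rw [← Measure.compProd_map hf, h_kernel, map_compProd_comap _ _ hF]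
    _ = (ν.map fun ρ n => f (ρ n)).map (Preorder.frestrictLe n) ⊗ₘ T'.historyKernel n := by
        rw [Measure.map_map (by fun_prop) (by fun_prop),
          Measure.map_map (by fun_prop) (by fun_prop)]
        rfl

theorem IsMarkovChain.ext [IsFiniteMeasure ν'] (hν : T.IsMarkovChain ν) (hν' : T.IsMarkovChain ν')
    (h₀ : ν.map (fun ρ => ρ 0) = ν'.map fun ρ => ρ 0) : ν = ν' := by
  refine ext_of_map_frestrictLe fun n => ?_
  induction n with
  | zero =>
    have h_const : Preorder.frestrictLe (π := fun _ => S) 0 =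
        (fun s _ => s) ∘ fun ρ : ℕ → S => ρ 0 := by
      ext ρ ⟨i, hi⟩
      obtain rfl : i = 0 := by simpa using hi
      rfl
    rw [h_const, ← Measure.map_map (by fun_prop) (by fun_prop), h₀,
      Measure.map_map (by fun_prop) (by fun_prop)]
  | succ n ih =>
    let glue : (Finset.Iic n → S) × S → Finset.Iic (n + 1) → S :=
      IicProdIoc (X := fun _ => S) n (n + 1) ∘
        Prod.map id (MeasurableEquiv.piSingleton (X := fun _ => S) n)
    have h_meas : Measurable glue :=
      measurable_IicProdIoc.comp (measurable_id.prodMap (MeasurableEquiv.measurable _))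
    have h_glue : Preorder.frestrictLe (π := fun _ => S) (n + 1) =
        glue ∘ fun ρ => (Preorder.frestrictLe (π := fun _ => S) n ρ, ρ (n + 1)) := by
      ext ρ ⟨i, hi⟩
      rcases Nat.le_succ_iff.1 (Finset.mem_Iic.1 hi) with h | rfl <;>
        simp [glue, IicProdIoc_def, MeasurableEquiv.piSingleton, *]
    rw [h_glue, ← Measure.map_map h_meas (by fun_prop), hν n, ih, ← hν' n,
      Measure.map_map h_meas (by fun_prop)]

variable (T)

theorem pathMeasure_map [IsProbabilityMeasure μ] (hf : Measurable f)
    (h : ∀ s, (T.kernel s).map f = T'.kernel (f s)) :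
    (T.pathMeasure μ).map (fun ρ n => f (ρ n)) = T'.pathMeasure (μ.map f) := by
  have := Measure.isProbabilityMeasure_map (μ := μ) hf.aemeasurable
  refine IsMarkovChain.ext ((T.isMarkovChain_pathMeasure μ).map hf h)
    (T'.isMarkovChain_pathMeasure _) ?_
  calc ((T.pathMeasure μ).map fun ρ n => f (ρ n)).map (fun ρ => ρ 0)
      = ((T.pathMeasure μ).map fun ρ => ρ 0).map f := by
        rw [Measure.map_map (by fun_prop) (by fun_prop), Measure.map_map hf (by fun_prop)]
        rfl
    _ = (T'.pathMeasure (μ.map f)).map fun ρ => ρ 0 := by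
        rw [pathMeasure_map_eval_zero, pathMeasure_map_eval_zero]

theorem pathMeasure_map_shift [IsProbabilityMeasure μ] :
    (T.pathMeasure μ).map (fun ρ n => ρ (n + 1)) = T.pathMeasure (T.transform μ) := by
  have h_chain := T.isMarkovChain_pathMeasure μ
  refine h_chain.map_shift.ext (T.isMarkovChain_pathMeasure _) ?_
  calc ((T.pathMeasure μ).map fun ρ n => ρ (n + 1)).map (fun ρ => ρ 0)
      = (T.pathMeasure μ).map fun ρ => ρ 1 := Measure.map_map (by fun_prop) (by fun_prop)
    _ = T.transform μ := by rw [h_chain.map_eval_one, pathMeasure_map_eval_zero]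
    _ = (T.pathMeasure (T.transform μ)).map fun ρ => ρ 0 := (pathMeasure_map_eval_zero _ _).symm

theorem pathMeasure_map_shift_iterate [IsProbabilityMeasure μ] (k : ℕ) :
    (T.pathMeasure μ).map (fun ρ n => ρ (n + k)) = T.pathMeasure (T.transform^[k] μ) := by
  induction k generalizing μ with
  | zero => exact Measure.map_id
  | succ k ih =>
    rw [Function.iterate_succ_apply, ← ih, ← pathMeasure_map_shift,
      Measure.map_map (by fun_prop) (by fun_prop)]
    rfl

theorem pathMeasure_map_eval [IsProbabilityMeasure μ] (k : ℕ) :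
    (T.pathMeasure μ).map (fun ρ => ρ k) = T.transform^[k] μ := by
  rw [← T.pathMeasure_map_eval_zero (T.transform^[k] μ), ← pathMeasure_map_shift_iterate,
    Measure.map_map (by fun_prop) (by fun_prop)]
  simp [Function.comp_def]

theorem pathKernel_preimage_shift (s : S) {E : Set (ℕ → S)} (hE : MeasurableSet E) :
    T.pathKernel s ((fun ρ n => ρ (n + 1)) ⁻¹' E) = ∫⁻ t, T.pathKernel t E ∂T.kernel s := by
  rw [← pathMeasure_dirac, ← Measure.map_apply (by fun_prop) hE, pathMeasure_map_shift,
    transform, Measure.dirac_bind T.kernel.measurable, pathMeasure_eq_bind_pathKernel,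
    Measure.bind_apply hE (Kernel.aemeasurable _)]

theorem ae_pathMeasure_shift [IsProbabilityMeasure μ] (k : ℕ) {C : Set S}
    (hC : MeasurableSet C) {E : Set (ℕ → S)} (hE : MeasurableSet E)
    (h : ∀ s ∈ C, ∀ᵐ ρ ∂T.pathKernel s, ρ ∈ E) :
    ∀ᵐ ρ ∂T.pathMeasure μ, ρ k ∈ C → (fun n => ρ (n + k)) ∈ E := by
  have h_meas : MeasurableSet {ρ : ℕ → S | ρ 0 ∈ C → ρ ∈ E} := by measurability
  have h_start : ∀ s, ∀ᵐ ρ ∂T.pathKernel s, ρ 0 ∈ C → ρ ∈ E := fun s => by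
    by_cases hs : s ∈ C
    · filter_upwards [h s hs] with ρ hρ _ using hρ
    · filter_upwards [T.ae_pathKernel_eval_zero s hC.compl hs] with ρ hρ hρC using absurd hρC hρ
  have h_map : ∀ᵐ ρ ∂(T.pathMeasure μ).map (fun ρ n => ρ (n + k)), ρ 0 ∈ C → ρ ∈ E := by
    rw [pathMeasure_map_shift_iterate, pathMeasure_eq_bind_pathKernel]
    exact Measure.ae_comp_of_ae_ae h_meas (ae_of_all _ h_start)
  have h_shift : Measurable fun (ρ : ℕ → S) n => ρ (n + k) := by fun_prop
  simpa using ae_of_ae_map h_shift.aemeasurable h_map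

end PathMeasure

section Hitting

variable {S : Type*}

/-- The event that the path visits `B` before time `n` (time `n` excluded). -/
def eventuallyBefore (n : ℕ) (B : Set S) : Set (ℕ → S) := {ρ | ∃ i < n, ρ i ∈ B}

theorem monotone_eventuallyBefore (B : Set S) : Monotone fun n => eventuallyBefore n B :=
  fun _ _ hmn _ ⟨i, hi, hiB⟩ => ⟨i, hi.trans_le hmn, hiB⟩

theorem eventuallyBefore_zero (B : Set S) : eventuallyBefore 0 B = ∅ := by
  simp [eventuallyBefore]

theorem iUnion_eventuallyBefore (B : Set S) : ⋃ n, eventuallyBefore n B = eventually B := by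
  ext ρ
  simp only [Set.mem_iUnion]
  exact ⟨fun ⟨_, i, _, hi⟩ => ⟨i, hi⟩, fun ⟨i, hi⟩ => ⟨i + 1, i, i.lt_succ_self, hi⟩⟩

variable [MeasurableSpace S] (T : STS S) {A B : Set S}

theorem measurableSet_eventually (hB : MeasurableSet B) : MeasurableSet (eventually B) := by
  simp only [eventually, Set.ofPred_exists]
  exact .iUnion fun n => measurable_pi_apply n hB

theorem measurableSet_eventuallyBefore (n : ℕ) (hB : MeasurableSet B) :
    MeasurableSet (eventuallyBefore n B) := by
  simp only [eventuallyBefore, Set.ofPred_exists, ← exists_prop]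
  exact .iUnion fun i => .iUnion fun _ => measurable_pi_apply i hB

theorem eventuallyBefore_succ_ae_eq (hB : MeasurableSet B) {s : S} (hs : s ∉ B) (n : ℕ) :
    eventuallyBefore (n + 1) B =ᵐ[T.pathKernel s]
      (fun ρ n => ρ (n + 1)) ⁻¹' eventuallyBefore n B := by
  filter_upwards [T.ae_pathKernel_eval_zero s hB.compl hs] with ρ hρ
  refine propext ⟨?_, fun ⟨i, hi, hiB⟩ => ⟨i + 1, Nat.succ_lt_succ hi, hiB⟩⟩
  rintro ⟨_ | i, hi, hiB⟩
  exacts [absurd hiB hρ, ⟨i, Nat.lt_of_succ_lt_succ hi, hiB⟩]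

theorem pathKernel_eventually_of_mem (hB : MeasurableSet B) {s : S} (hs : s ∈ B) :
    T.pathKernel s (eventually B) = 1 := by
  rw [← mem_ae_iff_prob_eq_one (measurableSet_eventually hB)]
  filter_upwards [T.ae_pathKernel_eval_zero s hB hs] with ρ hρ using ⟨0, hρ⟩

theorem lintegral_pathKernel_eventually_le (hB : MeasurableSet B) (s : S) :
    ∫⁻ t, T.pathKernel t (eventually B) ∂T.kernel s ≤ T.pathKernel s (eventually B) := by
  rw [← pathKernel_preimage_shift _ _ (measurableSet_eventually hB)]
  exact measure_mono fun ρ ⟨n, hn⟩ => ⟨n + 1, hn⟩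

theorem pathKernel_compl_eventually_le_lintegral (hB : MeasurableSet B) (s : S) :
    T.pathKernel s (eventually B)ᶜ ≤ ∫⁻ t, T.pathKernel t (eventually B)ᶜ ∂T.kernel s := by
  rw [← pathKernel_preimage_shift _ _ (measurableSet_eventually hB).compl]
  exact measure_mono fun ρ hρ ⟨n, hn⟩ => hρ ⟨n + 1, hn⟩

theorem mul_pathKernel_eventually_le (hA : MeasurableSet A) {h : S → ENNReal}
    (h_super : ∀ s, ∫⁻ t, h t ∂T.kernel s ≤ h s) {c : ENNReal} (hc : ∀ s ∈ A, c ≤ h s) (s : S) :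
    c * T.pathKernel s (eventually A) ≤ h s := by
  have h_before (n : ℕ) : ∀ s, c * T.pathKernel s (eventuallyBefore n A) ≤ h s := by
    induction n with
    | zero => simp [eventuallyBefore_zero]
    | succ n ih =>
      intro s
      by_cases hs : s ∈ A
      · exact (mul_le_of_le_one_right' prob_le_one).trans (hc s hs)
      have h_meas := measurableSet_eventuallyBefore n hA
      calc c * T.pathKernel s (eventuallyBefore (n + 1) A)
          = c * ∫⁻ t, T.pathKernel t (eventuallyBefore n A) ∂T.kernel s := by
            rw [measure_congr (T.eventuallyBefore_succ_ae_eq hA hs n),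
              pathKernel_preimage_shift _ _ h_meas]
        _ = ∫⁻ t, c * T.pathKernel t (eventuallyBefore n A) ∂T.kernel s :=
            (lintegral_const_mul _ (Kernel.measurable_coe _ h_meas)).symm
        _ ≤ ∫⁻ t, h t ∂T.kernel s := lintegral_mono ih
        _ ≤ h s := h_super s
  rw [← iUnion_eventuallyBefore, (monotone_eventuallyBefore A).measure_iUnion, ENNReal.mul_iSup]
  exact iSup_le fun n => h_before n s

theorem le_mul_pathKernel_compl_eventually (hB : MeasurableSet B) {h : S → ENNReal}
    (h_zero : ∀ s ∈ B, h s = 0) (h_sub : ∀ s ∉ B, h s ≤ ∫⁻ t, h t ∂T.kernel s) {K : ENNReal}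
    (hK : K ≠ ⊤) (h_le : ∀ s, h s ≤ K) (s : S) : h s ≤ K * T.pathKernel s (eventually B)ᶜ := by
  have h_before (n : ℕ) : ∀ s, h s ≤ K * T.pathKernel s (eventuallyBefore n B)ᶜ := by
    induction n with
    | zero => simpa [eventuallyBefore_zero] using h_le
    | succ n ih =>
      intro s
      by_cases hs : s ∈ B
      · simp [h_zero s hs]
      have h_meas := (measurableSet_eventuallyBefore n hB).compl
      calc h s ≤ ∫⁻ t, h t ∂T.kernel s := h_sub s hs
        _ ≤ ∫⁻ t, K * T.pathKernel t (eventuallyBefore n B)ᶜ ∂T.kernel s := lintegral_mono ih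
        _ = K * ∫⁻ t, T.pathKernel t (eventuallyBefore n B)ᶜ ∂T.kernel s :=
            lintegral_const_mul _ (Kernel.measurable_coe _ h_meas)
        _ = K * T.pathKernel s (eventuallyBefore (n + 1) B)ᶜ := by
            rw [measure_congr (T.eventuallyBefore_succ_ae_eq hB hs n).compl,
              ← pathKernel_preimage_shift _ _ h_meas, Set.preimage_compl]
  have h_lim := tendsto_measure_iInter_atTop (μ := T.pathKernel s)
    (fun n => (measurableSet_eventuallyBefore n hB).compl.nullMeasurableSet)
    (fun _ _ hmn => Set.compl_subset_compl.2 (monotone_eventuallyBefore B hmn))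
    ⟨0, measure_ne_top _ _⟩
  rw [← Set.compl_iUnion, iUnion_eventuallyBefore] at h_lim
  exact ge_of_tendsto' (ENNReal.Tendsto.const_mul h_lim (.inr hK)) fun n => h_before n s

theorem pathKernel_eventually_eq_one_of_le (hB : MeasurableSet B) {c : ENNReal} (hc₀ : c ≠ 0)
    (hc : ∀ s, c ≤ T.pathKernel s (eventually B)) (s : S) :
    T.pathKernel s (eventually B) = 1 := by
  have hE := measurableSet_eventually hB
  -- Bounding the escape probability by `1 - c` improves itself by the factor `1 - c < 1`.
  have h_contract : T.pathKernel s (eventually B)ᶜ ≤ (1 - c) * T.pathKernel s (eventually B)ᶜ := by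
    refine T.le_mul_pathKernel_compl_eventually hB
      (h := fun s => T.pathKernel s (eventually B)ᶜ) (fun t ht => ?_)
      (fun t _ => T.pathKernel_compl_eventually_le_lintegral hB t) (by simp) (fun t => ?_) s
    · exact (prob_compl_eq_zero_iff hE).2 (T.pathKernel_eventually_of_mem hB ht)
    · rw [prob_compl_eq_one_sub hE]
      exact tsub_le_tsub_left (hc t) 1
  rw [← prob_compl_eq_zero_iff hE]
  by_contra h_ne
  refine h_contract.not_gt ?_
  calc (1 - c) * T.pathKernel s (eventually B)ᶜ < 1 * T.pathKernel s (eventually B)ᶜ :=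
        ENNReal.mul_lt_mul_left h_ne (measure_ne_top _ _)
          (ENNReal.sub_lt_self (by simp) (by simp) hc₀)
    _ = T.pathKernel s (eventually B)ᶜ := one_mul _

end Hitting

section Reachability

variable {Y : Type*} [MeasurableSpace Y] (T : STS Y)

/-- Reachability in the transition graph of `T`, whose edges are the transitions of positive
probability; it is meant for denumerable chains. -/
def Reach : Y → Y → Prop := Relation.ReflTransGen fun x y => T.kernel x {y} ≠ 0

variable [Countable Y] [DiscreteMeasurableSpace Y]

theorem transform_singleton_ne_zero_iff (ν : Measure Y) (y : Y) :
    T.transform ν {y} ≠ 0 ↔ ∃ x, ν {x} ≠ 0 ∧ T.kernel x {y} ≠ 0 := by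
  rw [transform, Measure.bind_apply .of_discrete (Kernel.aemeasurable _), lintegral_countable']
  simp [and_comm]

theorem exists_iterate_transform_singleton_ne_zero_iff (ν : Measure Y) (y : Y) :
    (∃ n, T.transform^[n] ν {y} ≠ 0) ↔ ∃ x, ν {x} ≠ 0 ∧ T.Reach x y := by
  constructor
  · rintro ⟨n, hn⟩
    induction n generalizing y with
    | zero => exact ⟨y, hn, .refl⟩
    | succ n ih =>
      rw [Function.iterate_succ_apply', transform_singleton_ne_zero_iff] at hn
      obtain ⟨z, hz, hzy⟩ := hn
      obtain ⟨x, hx, hxz⟩ := ih z hz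
      exact ⟨x, hx, hxz.tail hzy⟩
  · rintro ⟨x, hx, hxy⟩
    induction hxy with
    | refl => exact ⟨0, hx⟩
    | tail _ hyz ih =>
      obtain ⟨n, hn⟩ := ih
      refine ⟨n + 1, ?_⟩
      rw [Function.iterate_succ_apply', transform_singleton_ne_zero_iff]
      exact ⟨_, hn, hyz⟩

theorem pathKernel_eventually_ne_zero {B : Set Y} {x y : Y} (hxy : T.Reach x y) (hy : y ∈ B) :
    T.pathKernel x (eventually B) ≠ 0 := by
  obtain ⟨n, hn⟩ := (T.exists_iterate_transform_singleton_ne_zero_iff (.dirac x) y).2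
    ⟨x, by simp, hxy⟩
  rw [← pathMeasure_map_eval, pathMeasure_dirac,
    Measure.map_apply (by fun_prop) (measurableSet_singleton y)] at hn
  refine fun h => hn (measure_mono_null ?_ h)
  rintro ρ (rfl : ρ n = y)
  exact ⟨n, hy⟩

theorem ae_pathKernel_reach (x : Y) : ∀ᵐ ρ ∂T.pathKernel x, ∀ n, T.Reach x (ρ n) := by
  refine ae_all_iff.2 fun n => ae_of_ae_map (measurable_pi_apply n).aemeasurable ?_
  rw [← pathMeasure_dirac, pathMeasure_map_eval, ae_iff_of_countable]
  intro y hy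
  obtain ⟨z, hz, hzy⟩ := (T.exists_iterate_transform_singleton_ne_zero_iff _ y).1 ⟨n, hy⟩
  obtain rfl : x = z := by simpa [Set.indicator_apply] using hz
  exact hzy

theorem pathKernel_eventually_eq_one_of_reach {A B : Set Y} (hAf : A.Finite)
    (hA : ∀ y, T.pathKernel y (eventually A) = 1) (hAB : ∀ a ∈ A, ∃ b ∈ B, T.Reach a b) (y : Y) :
    T.pathKernel y (eventually B) = 1 := by
  let c : ENNReal := hAf.toFinset.inf fun a => T.pathKernel a (eventually B)
  have hc₀ : 0 < c := (Finset.lt_inf_iff (by simp)).2 fun a ha => by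
    obtain ⟨b, hb, hab⟩ := hAB a (hAf.mem_toFinset.1 ha)
    exact pos_iff_ne_zero.2 (T.pathKernel_eventually_ne_zero hab hb)
  have hc (x : Y) : c ≤ T.pathKernel x (eventually B) := by
    have h_le := T.mul_pathKernel_eventually_le (A := A) (c := c) .of_discrete
      (T.lintegral_pathKernel_eventually_le (B := B) .of_discrete)
      (fun a ha => Finset.inf_le (hAf.mem_toFinset.2 ha)) x
    rwa [hA, mul_one] at h_le
  exact T.pathKernel_eventually_eq_one_of_le .of_discrete hc₀.ne' hc y

/-- A state is recurrent if, wherever the chain started from it goes, it almost surely goes on to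
visit every state reachable from it. With a finite attractor, these are the states of the bottom
strongly connected components of the transition graph. -/
def IsRecurrent (r : Y) : Prop :=
  ∀ x y, T.Reach r x → T.Reach r y → T.pathKernel x (eventually {y}) = 1

theorem isRecurrent_of_forall_reach {A : Set Y} (hAf : A.Finite)
    (hA : ∀ y, T.pathKernel y (eventually A) = 1) {r : Y}
    (hr : ∀ a ∈ A, T.Reach r a → T.Reach a r) : T.IsRecurrent r := by
  intro x y hrx hry
  have h_leave : T.pathKernel x (eventually ({y} ∪ {z | ¬T.Reach r z})) = 1 := by
    refine T.pathKernel_eventually_eq_one_of_reach hAf hA (fun a ha => ?_) x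
    by_cases hra : T.Reach r a
    · exact ⟨y, .inl rfl, (hr a ha hra).trans hry⟩
    · exact ⟨a, .inr hra, .refl⟩
  rw [← mem_ae_iff_prob_eq_one (measurableSet_eventually .of_discrete)] at h_leave ⊢
  filter_upwards [h_leave, T.ae_pathKernel_reach x] with ρ ⟨n, hn⟩ hρ
  exact ⟨n, hn.resolve_right fun h => h (hrx.trans (hρ n))⟩

theorem pathKernel_eventually_isRecurrent {A : Set Y} (hAf : A.Finite)
    (hA : ∀ y, T.pathKernel y (eventually A) = 1) (y : Y) :
    T.pathKernel y (eventually {r | T.IsRecurrent r}) = 1 := by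
  refine T.pathKernel_eventually_eq_one_of_reach hAf hA (fun a ha => ?_) y
  obtain ⟨r, ⟨_, har⟩, h_min⟩ :=
    (hAf.inter_of_left {r | T.Reach a r}).exists_minimalFor (fun r => {x | T.Reach r x}) _
      ⟨a, ha, .refl⟩
  refine ⟨r, T.isRecurrent_of_forall_reach hAf hA fun x hx hrx => ?_, har⟩
  exact h_min ⟨hx, har.trans hrx⟩ (fun _ hxz => hrx.trans hxz) .refl

end Reachability

section Abstraction

variable {S Y : Type*} [MeasurableSpace S] [MeasurableSpace Y] {T : STS S} {T' : STS Y} {α : S → Y}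

theorem isAttractor_iff {B : Set S} :
    T.IsAttractor B ↔ MeasurableSet B ∧ ∀ s, T.pathKernel s (eventually B) = 1 := by
  refine and_congr_right fun hB => ⟨fun h s => ?_, fun h μ _ => ?_⟩
  · rw [← pathMeasure_dirac]
    exact h _ inferInstance
  · rw [pathMeasure_eq_bind_pathKernel,
      Measure.bind_apply (measurableSet_eventually hB) (Kernel.aemeasurable _)]
    simp [h]

theorem IsAttractor.preimage {B : Set Y} (hB : T'.IsAttractor B) (hα : Measurable α)
    (h : ∀ s, (T.kernel s).map α = T'.kernel (α s)) : T.IsAttractor (α ⁻¹' B) := by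
  refine ⟨hα hB.1, fun μ _ => ?_⟩
  rw [← hB.2 (μ.map α) (Measure.isProbabilityMeasure_map hα.aemeasurable),
    ← T.pathMeasure_map μ hα h, Measure.map_apply (by fun_prop) (measurableSet_eventually hB.1)]
  rfl

theorem IsAttractor.setOf_isRecurrent [Countable Y] [DiscreteMeasurableSpace Y] {A : Set Y}
    (hA : T'.IsAttractor A) (hAf : A.Finite) : T'.IsAttractor {r | T'.IsRecurrent r} :=
  isAttractor_iff.2
    ⟨.of_discrete, T'.pathKernel_eventually_isRecurrent hAf (isAttractor_iff.1 hA).2⟩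

theorem transform_eq_zero_iff {μ : Measure S} {A : Set S} (hA : MeasurableSet A) :
    T.transform μ A = 0 ↔ ∀ᵐ s ∂μ, T.kernel s A = 0 := by
  rw [transform, Measure.bind_apply hA (Kernel.aemeasurable _),
    lintegral_eq_zero_iff (Kernel.measurable_coe _ hA)]
  rfl

theorem isAbstraction_iff (hα : Measurable α) :
    IsAbstraction α T T' ↔
      ∀ s A, MeasurableSet A → (T.kernel s (α ⁻¹' A) = 0 ↔ T'.kernel (α s) A = 0) := by
  refine ⟨fun h s A hA => ?_, fun h μ _ A hA => ?_⟩
  · have h_dirac := h (.dirac s) inferInstance A hA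
    rwa [transform, transform, Measure.map_dirac' hα, Measure.dirac_bind T.kernel.measurable,
      Measure.dirac_bind T'.kernel.measurable, Measure.map_apply hα hA] at h_dirac
  · have h_null : MeasurableSet {y | T'.kernel y A = 0} :=
      T'.kernel.measurable_coe hA (measurableSet_singleton 0)
    rw [Measure.map_apply hα hA, transform_eq_zero_iff (hα hA), transform_eq_zero_iff hA,
      ae_map_iff hα.aemeasurable h_null]
    simp only [h _ A hA]

theorem IsAbstraction.refl (T : STS S) : IsAbstraction id T T := fun μ _ A _ => by
  simp only [Measure.map_id]

theorem IsSound.refl (T : STS S) : IsSound id T T := fun μ _ B _ h => by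
  rwa [Measure.map_id] at h

theorem IsAbstraction.iterate_transform_eq_zero_iff (h : IsAbstraction α T T') (μ : Measure S)
    [IsProbabilityMeasure μ] (n : ℕ) {A : Set Y} (hA : MeasurableSet A) :
    (T.transform^[n] μ).map α A = 0 ↔ T'.transform^[n] (μ.map α) A = 0 := by
  induction n generalizing A with
  | zero => rfl
  | succ n ih =>
    have : IsProbabilityMeasure (T.transform^[n] μ) := by
      rw [← pathMeasure_map_eval]
      exact Measure.isProbabilityMeasure_map (measurable_pi_apply n).aemeasurable
    have h_null := (T'.kernel.measurable_coe hA (measurableSet_singleton 0)).compl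
    rw [Function.iterate_succ_apply', Function.iterate_succ_apply', h _ inferInstance A hA,
      transform_eq_zero_iff hA, transform_eq_zero_iff hA]
    exact ih h_null

theorem IsSound.pathKernel_eventually (h : IsSound α T T') (hα : Measurable α) {s : S} {B : Set Y}
    (hB : MeasurableSet B) (hs : T'.pathKernel (α s) (eventually B) = 1) :
    T.pathKernel s (eventually (α ⁻¹' B)) = 1 := by
  rw [← pathMeasure_dirac] at hs ⊢
  rw [← Measure.map_dirac' hα] at hs
  exact h _ inferInstance B hB hs

variable [Countable Y] [DiscreteMeasurableSpace Y]

theorem IsAbstraction.exists_pathMeasure_ne_zero_iff (h : IsAbstraction α T T') (hα : Measurable α)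
    (μ : Measure S) [IsProbabilityMeasure μ] (y : Y) :
    (∃ n, T.pathMeasure μ {ρ | α (ρ n) = y} ≠ 0) ↔ ∃ x, μ.map α {x} ≠ 0 ∧ T'.Reach x y := by
  rw [← exists_iterate_transform_singleton_ne_zero_iff]
  refine exists_congr fun n => not_congr ?_
  rw [← h.iterate_transform_eq_zero_iff μ n (measurableSet_singleton y), ← pathMeasure_map_eval,
    Measure.map_map hα (measurable_pi_apply n),
    Measure.map_apply (by fun_prop) (measurableSet_singleton y)]
  rfl

theorem IsAbstraction.ae_reach (h : IsAbstraction α T T') (hα : Measurable α) (μ : Measure S)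
    [IsProbabilityMeasure μ] :
    ∀ᵐ ρ ∂T.pathMeasure μ, ∀ n, ∃ x, μ.map α {x} ≠ 0 ∧ T'.Reach x (α (ρ n)) := by
  simp only [← h.exists_pathMeasure_ne_zero_iff hα]
  refine ae_all_iff.2 fun n => ?_
  have h_meas : Measurable fun ρ : ℕ → S => α (ρ n) := by fun_prop
  refine ae_of_ae_map (p := fun y => ∃ n, T.pathMeasure μ {ρ | α (ρ n) = y} ≠ 0)
    h_meas.aemeasurable (ae_iff_of_countable.2 fun y hy => ⟨n, ?_⟩)
  rwa [Measure.map_apply h_meas (measurableSet_singleton y)] at hy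

theorem IsAbstraction.ae_pathKernel_reach (h : IsAbstraction α T T') (hα : Measurable α) (s : S) :
    ∀ᵐ ρ ∂T.pathKernel s, ∀ n, T'.Reach (α s) (α (ρ n)) := by
  rw [← pathMeasure_dirac]
  filter_upwards [h.ae_reach hα (.dirac s)] with ρ hρ n
  obtain ⟨x, hx, hxn⟩ := hρ n
  rw [Measure.map_dirac' hα] at hx
  obtain rfl : α s = x := by simpa [Set.indicator_apply] using hx
  exact hxn

theorem IsSound.ae_frequently_eq (hsound : IsSound α T T') (h : IsAbstraction α T T')
    (hα : Measurable α) {s : S} (hs : T'.IsRecurrent (α s)) {y : Y} (hy : T'.Reach (α s) y) :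
    ∀ᵐ ρ ∂T.pathKernel s, ∃ᶠ n in Filter.atTop, α (ρ n) = y := by
  have h_visit (t : S) (ht : T'.Reach (α s) (α t)) :
      ∀ᵐ ρ ∂T.pathKernel t, ρ ∈ eventually (α ⁻¹' {y}) :=
    (mem_ae_iff_prob_eq_one (measurableSet_eventually (hα .of_discrete))).2
      (hsound.pathKernel_eventually hα .of_discrete (hs _ _ ht hy))
  have h_revisit := ae_all_iff.2 fun k => T.ae_pathMeasure_shift (.dirac s) k
    (C := α ⁻¹' {z | T'.Reach (α s) z}) (hα .of_discrete)
    (measurableSet_eventually (hα .of_discrete)) h_visit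
  rw [pathMeasure_dirac] at h_revisit
  filter_upwards [h_revisit, h.ae_pathKernel_reach hα s] with ρ h_shift h_reach
  refine Filter.frequently_atTop.2 fun k => ?_
  obtain ⟨n, hn⟩ := h_shift k (h_reach k)
  exact ⟨n + k, Nat.le_add_left k n, hn⟩

end Abstraction

end STS

namespace LSTS

section Inf

variable {S AP : Type*} [MeasurableSpace S] (T : LSTS S AP)

theorem mem_inf_iff_frequently {a : AP} {ρ : ℕ → S} :
    a ∈ T.inf ρ ↔ ∃ᶠ n in Filter.atTop, a ∈ T.label (ρ n) :=
  Nat.frequently_atTop_iff_infinite.symm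

theorem inf_shift (ρ : ℕ → S) (k : ℕ) : T.inf (fun n => ρ (n + k)) = T.inf ρ := by
  ext a
  rw [mem_inf_iff_frequently, mem_inf_iff_frequently]
  conv_rhs => rw [← Filter.map_add_atTop_eq_nat k, Filter.frequently_map]

theorem measurable_inf : Measurable T.inf := by
  refine measurable_set_iff.2 fun a => ?_
  simp only [mem_inf_iff_frequently, Filter.frequently_atTop]
  exact .forall fun k => .exists fun n => measurable_const.and <|
    (measurable_set_iff.1 T.measurable_label a).comp (measurable_pi_apply n)

/-- The labels of the states reachable from `r`: from a recurrent state of a denumerable chain,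
these are almost surely the labels seen infinitely often. -/
def reachLabels (r : S) : Set AP := {a | ∃ y, T.Reach r y ∧ a ∈ T.label y}

end Inf

section Abstraction

variable {S Y AP : Type*} [MeasurableSpace S] [MeasurableSpace Y] {T : LSTS S AP}
  {T' : LSTS Y AP} {α : S → Y}

theorem IsAbstraction.refl (T : LSTS S AP) : IsAbstraction id T T :=
  ⟨.refl T.toSTS, fun _ _ h => congrArg T.label h, fun _ => rfl⟩

variable [Countable Y] [DiscreteMeasurableSpace Y]

theorem IsAbstraction.ae_inf_eq (h : IsAbstraction α T T')
    (hsound : STS.IsSound α T.toSTS T'.toSTS) (hα : Measurable α) {s : S}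
    (hs : T'.IsRecurrent (α s)) :
    ∀ᵐ ρ ∂T.pathKernel s, T.inf ρ = T'.reachLabels (α s) := by
  have h_freq : ∀ᵐ ρ ∂T.pathKernel s,
      ∀ y, T'.Reach (α s) y → ∃ᶠ n in Filter.atTop, α (ρ n) = y := by
    refine ae_all_iff.2 fun y => ?_
    by_cases hy : T'.Reach (α s) y
    · filter_upwards [hsound.ae_frequently_eq h.toSTS hα hs hy] with ρ hρ _ using hρ
    · exact ae_of_all _ fun ρ h => absurd h hy
  filter_upwards [h_freq, h.toSTS.ae_pathKernel_reach hα s] with ρ h_freq h_reach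
  ext a
  rw [mem_inf_iff_frequently]
  refine ⟨fun ha => ?_, fun ⟨y, hy, hay⟩ => (h_freq y hy).mono fun n hn => ?_⟩
  · obtain ⟨n, hn⟩ := ha.exists
    exact ⟨α (ρ n), h_reach n, by rwa [h.label_map]⟩
  · rwa [← h.label_map, hn]

variable [Countable AP]

theorem IsAbstraction.ae_inf_eq_of_isRecurrent (h : IsAbstraction α T T')
    (hsound : STS.IsSound α T.toSTS T'.toSTS) (hα : Measurable α) (μ : Measure S)
    [IsProbabilityMeasure μ] :
    ∀ᵐ ρ ∂T.pathMeasure μ,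
      ∀ n, T'.IsRecurrent (α (ρ n)) → T.inf ρ = T'.reachLabels (α (ρ n)) := by
  have h_state (n : ℕ) (r : Y) := T.ae_pathMeasure_shift μ n
    (C := α ⁻¹' {y | y = r ∧ T'.IsRecurrent r}) (hα .of_discrete)
    (T.measurable_inf (measurableSet_singleton (T'.reachLabels r))) fun s ⟨hs, hr⟩ => by
      subst hs
      exact h.ae_inf_eq hsound hα hr
  filter_upwards [ae_all_iff.2 fun n => ae_all_iff.2 (h_state n)] with ρ hρ n hn
  rw [← T.inf_shift ρ n]
  exact hρ n _ ⟨rfl, hn⟩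

theorem IsAbstraction.pathMeasure_inf_mem_eq_one_iff (h : IsAbstraction α T T')
    (hsound : STS.IsSound α T.toSTS T'.toSTS) (hα : Measurable α)
    (hrec : T'.IsAttractor {r | T'.IsRecurrent r}) {F : Set (Set AP)} (hF : MeasurableSet F)
    (μ : Measure S) [IsProbabilityMeasure μ] :
    T.pathMeasure μ {ρ | T.inf ρ ∈ F} = 1 ↔
      ∀ r, T'.IsRecurrent r → (∃ x, μ.map α {x} ≠ 0 ∧ T'.Reach x r) → T'.reachLabels r ∈ F := by
  have h_inf := h.ae_inf_eq_of_isRecurrent hsound hα μ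
  rw [← mem_ae_iff_prob_eq_one (s := {ρ | T.inf ρ ∈ F}) (T.measurable_inf hF)]
  refine ⟨fun h_mem r hr hxr => ?_, fun h_labels => ?_⟩
  · obtain ⟨n, hn⟩ := (h.toSTS.exists_pathMeasure_ne_zero_iff hα μ r).2 hxr
    obtain ⟨ρ, rfl, hρF, hρ⟩ :=
      ((frequently_ae_iff.2 hn).and_eventually (Filter.Eventually.and h_mem h_inf)).exists
    rwa [← hρ n hr]
  · have h_hit : T.pathMeasure μ (STS.eventually (α ⁻¹' {r | T'.IsRecurrent r})) = 1 :=
      hsound μ inferInstance _ hrec.1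
        (hrec.2 _ (Measure.isProbabilityMeasure_map hα.aemeasurable))
    rw [← mem_ae_iff_prob_eq_one (STS.measurableSet_eventually (hα hrec.1))] at h_hit
    filter_upwards [h_hit, h.toSTS.ae_reach hα μ, h_inf] with ρ ⟨n, hn⟩ h_reach hρ
    exact Set.mem_of_eq_of_mem (hρ n hn) (h_labels _ hn (h_reach n))

theorem IsAbstraction.pathMeasure_inf_mem_eq_one_iff_map (h : IsAbstraction α T T')
    (hsound : STS.IsSound α T.toSTS T'.toSTS) (hα : Measurable α) {A : Set Y} (hAf : A.Finite)
    (hA : T'.IsAttractor A) {F : Set (Set AP)} (hF : MeasurableSet F) (μ : Measure S)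
    [IsProbabilityMeasure μ] :
    T.pathMeasure μ {ρ | T.inf ρ ∈ F} = 1 ↔ T'.pathMeasure (μ.map α) {ρ | T'.inf ρ ∈ F} = 1 := by
  have := Measure.isProbabilityMeasure_map (μ := μ) hα.aemeasurable
  have hrec := hA.setOf_isRecurrent hAf
  rw [h.pathMeasure_inf_mem_eq_one_iff hsound hα hrec hF,
    (IsAbstraction.refl T').pathMeasure_inf_mem_eq_one_iff (.refl _) measurable_id hrec hF,
    Measure.map_id]

end Abstraction

section Product

variable {S₁ S₂ AP Q : Type*} [MeasurableSpace S₁] [MeasurableSpace S₂] [Finite AP] [Finite Q]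
  [MeasurableSpace Q] [DiscreteMeasurableSpace Q] (T₁ : LSTS S₁ AP) {T₂ : LSTS S₂ AP}

theorem product_kernel_map_fst (M : DMA AP Q) (p : S₁ × Q) :
    ((T₁.product M).kernel p).map Prod.fst = T₁.kernel p.1 := by
  rw [product, Kernel.prod_apply]
  exact Measure.fst_prod

theorem product_kernel_eq_map (M : DMA AP Q) (p : S₁ × Q) :
    (T₁.product M).kernel p = (T₁.kernel p.1).map fun s => (s, M.next p.2 (T₁.label p.1)) := by
  rw [product, Kernel.prod_apply, Kernel.deterministic_apply, Measure.prod_dirac,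
    Kernel.comap_apply]

variable {T₁} {α : S₁ → S₂}

theorem IsAbstraction.product (h : IsAbstraction α T₁ T₂) (hα : Measurable α) (M : DMA AP Q) :
    IsAbstraction (Prod.map α id) (T₁.product M) (T₂.product M) where
  toSTS := by
    refine (STS.isAbstraction_iff (hα.prodMap measurable_id)).2 fun p A hA => ?_
    let q := M.next p.2 (T₁.label p.1)
    have h_section : Measurable fun y : S₂ => (y, q) := by fun_prop
    rw [product_kernel_eq_map, product_kernel_eq_map,
      Measure.map_apply (by fun_prop) (hα.prodMap measurable_id hA), Prod.map_fst, Prod.map_snd,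
      h.label_map, id, Measure.map_apply h_section hA]
    exact (STS.isAbstraction_iff hα).1 h.toSTS p.1 _ (h_section hA)
  label_eq_of_eq _ _ hp := congrArg (fun p => {p.2}) hp
  label_map _ := rfl

end Product

end LSTS

theorem mainTheorem8_general {S₁ S₂ AP Q : Type*}
    [MeasurableSpace S₁]
    [MeasurableSpace S₂] [Countable S₂] [DiscreteMeasurableSpace S₂]
    [Finite AP]
    [Finite Q] [MeasurableSpace Q] [DiscreteMeasurableSpace Q]
    (T₁ : LSTS S₁ AP) (T₂ : LSTS S₂ AP) (M : DMA AP Q)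
    (α : S₁ → S₂) (hα : Measurable α)
    (hattr : ∃ B : Set S₂, B.Finite ∧ T₂.toSTS.IsAttractor B)
    (habs : LSTS.IsAbstraction α T₁ T₂)
    (hsound : STS.IsSound (Prod.map α id) (T₁.product M).toSTS (T₂.product M).toSTS)
    (F : Set (Set Q)) (ν : Measure (S₁ × Q)) [IsProbabilityMeasure ν] :
    (T₁.product M).pathMeasure ν {ρ | (T₁.product M).inf ρ ∈ F} = 1 ↔
      (T₂.product M).pathMeasure (ν.map (Prod.map α id)) {ρ | (T₂.product M).inf ρ ∈ F} = 1 := by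
  obtain ⟨B, hBf, hB⟩ := hattr
  have h_finite : (Prod.fst ⁻¹' B : Set (S₂ × Q)).Finite :=
    Set.prod_univ (s := B) ▸ hBf.prod Set.finite_univ
  exact (habs.product hα M).pathMeasure_inf_mem_eq_one_iff_map hsound
    (hα.prodMap measurable_id) h_finite (hB.preimage measurable_fst (T₂.product_kernel_map_fst M))
    F.toFinite.measurableSet ν

theorem mainTheorem8 {S₁ S₂ AP Q : Type*}
    [MeasurableSpace S₁]
    [MeasurableSpace S₂] [Countable S₂] [DiscreteMeasurableSpace S₂]
    [Finite AP]
    [Finite Q] [MeasurableSpace Q] [DiscreteMeasurableSpace Q]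
    (T₁ : LSTS S₁ AP) (T₂ : LSTS S₂ AP) (M : DMA AP Q)
    (α : S₁ → S₂) (hα : Measurable α)
    (hattr : ∃ B : Set S₂, B.Finite ∧ T₂.toSTS.IsAttractor B)
    (habs : LSTS.IsAbstraction α T₁ T₂)
    (hsound : STS.IsSound (Prod.map α id) (T₁.product M).toSTS (T₂.product M).toSTS)
    (μ : Measure S₁) [IsProbabilityMeasure μ] :
    (T₁.product M).pathMeasure (μ.prod (Measure.dirac M.init))
        {ρ | (T₁.product M).inf ρ ∈ M.acc} = 1 ↔
      (T₂.product M).pathMeasure ((μ.prod (Measure.dirac M.init)).map (Prod.map α id))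
        {ρ | (T₂.product M).inf ρ ∈ M.acc} = 1 :=
  mainTheorem8_general T₁ T₂ M α hα hattr habs hsound M.acc _
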